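/- Let $M\ge 1$ and consider $M$ bosonic modes with annihilation operators $a_1,\dots,a_M$ acting on the Fock space with number basis $|n_1,\dots,n_M\rangle$. Let $U_M$ be a multiport beamsplitter, that is, a unitary for which there is an $M\times M$ unitary matrix $\mathcal U$ with $U_M^\dagger a_m U_M=\sum_{m'}\mathcal U_{m,m'}a_{m'}$ for all $m$, and suppose that for some complex numbers $c_{m,m'}$ $$\sqrt M\,U_M^\dagger a_m U_M = a_1+\sum_{m'\neq 1}c_{m,m'}a_{m'}\qquad\text{for all } m=1,\dots,M .$$ For a one-mode state (positive operator of unit trace) $\rho_1$ put $\mathcal U_M(\rho_1):=U_M\bigl(\rho_1\otimes|0\rangle\langle 0|^{\otimes (M-1)}\bigr)U_M^\dagger$. Let $a_+:=\frac1{\sqrt M}\sum_{m=1}^M a_m$ be the centre-of-mass mode, and let $a_{-2},\dots,a_{-M}$ be any relative modes completing $a_+$ to a system of $M$ modes satisfying the canonical commutation relations, in the sense that there is a unitary $W$ on the Fock space with $Wa_1W^\dagger=a_+$ and $Wa_mW^\dagger=a_{-m}$ for $m\ge2$. For a state $\rho$ of the $M$ modes let $\operatorname{tr}_-\rho:=\operatorname{tr}_{2}\cdots\operatorname{tr}_{M}\bigl[W^\dagger\rho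 W\bigr]$ be the reduced state of the centre-of-mass mode, i.e. the partial trace of $\rho$ over the relative modes, written in the number basis of $a_+$. For a one-mode state $\rho$ let the Glauber $P$ function $P_\rho$ be the generalised function on $\mathbb C$ with $\rho=\int_{\mathbb C}P_\rho(\beta)|\beta\rangle\langle\beta|\,d^2\beta$, where $|\beta\rangle$ are the coherent states; its Fourier transform is $$\widehat{P_\rho}(\xi)=e^{|\xi|^2}\,\frac1\pi\int_{\mathbb C}\langle\alpha|\rho|\alpha\rangle\, e^{\xi\alpha^*-\xi^*\alpha}\,d^2\alpha .$$ For $\tau>0$ its Gaussian smoothing is $$R_{\rho,\tau}(\alpha)=\frac1{\pi\tau}\int_{\mathbb C}P_\rho(\beta)e^{-|\alpha-\beta|^2/\tau}\,d^2\beta:=\frac1{\pi^2}\int_{\mathbb C}\widehat{P_\rho}(\xi)\,e^{-\tau|\xi|^2}e^{\alpha\xi^*-\alpha^*\xi}\,d^2\xi ,$$ and the nonclassicality depth $\tau_c(\rho)$ is the infimum of those $\tau>0$ for which $\widehat{P_\rho}(\xi)e^{-\tau|\xi|^2}$ is integrable and $R_{\rho,\tau}(\alpha)\ge0$ for all $\alpha\in\mathbb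 C$. Then, for every choice of the relative modes, the sum over number states defining the partial trace converges (unconditionally in operator norm), $$\operatorname{tr}_-[\mathcal U_M(\rho_1)]=\rho_1,\qquad\text{and hence}\qquad \tau_c\bigl(\operatorname{tr}_-[\mathcal U_M(\rho_1)]\bigr)=\tau_c(\rho_1).$$ -/

import Mathlib

open scoped ComplexOrder

noncomputable section

namespace CVModes

/-! ## Fock spaces and annihilation operators -/

/-- The Hilbert space of one bosonic mode in the number representation, `ℓ²(ℕ)`:
`ψ p` is the amplitude of the number state `|p⟩`. -/
abbrev SingleMode : Type := lp (fun _ : ℕ => ℂ) 2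

/-- The Hilbert space of `M` bosonic modes in the number representation, `ℓ²(ℕ^M)`:
`ψ n` is the amplitude of `|n₁, …, n_M⟩`. -/
abbrev Fock (M : ℕ) : Type := lp (fun _ : Fin M → ℕ => ℂ) 2

/-- The formal action of the annihilation operator of mode `m` on amplitudes,
`(a_m ψ)(n) = √(n_m + 1) ψ(n + e_m)`, that is `a_m |n⟩ = √(n_m) |n - e_m⟩`. -/
def lowering {M : ℕ} (m : Fin M) : ((Fin M → ℕ) → ℂ) →ₗ[ℂ] ((Fin M → ℕ) → ℂ) where
  toFun ψ n := (Real.sqrt ((n m : ℝ) + 1) : ℂ) * ψ (n + Pi.single m 1)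
  map_add' ψ φ := by
    funext n
    simp [mul_add]
  map_smul' c ψ := by
    funext n
    simp only [Pi.smul_apply, smul_eq_mul, RingHom.id_apply]
    ring

/-- The square-summable amplitudes whose image under `lowering m` is square-summable. -/
def annihilationDomain {M : ℕ} (m : Fin M) : Submodule ℂ (Fock M) where
  carrier := {ψ | Memℓp (lowering m ψ) 2}
  add_mem' {ψ φ} hψ hφ := by
    have h := Memℓp.add hψ hφ
    rw [← map_add] at h
    exact h
  zero_mem' := by
    have h : lowering m (⇑(0 : Fock M)) = 0 := map_zero (lowering m)
    change Memℓp (lowering m (⇑(0 : Fock M))) 2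
    rw [h]
    exact zero_memℓp
  smul_mem' c ψ hψ := by
    have h := Memℓp.const_smul (𝕜 := ℂ) hψ c
    rw [← map_smul] at h
    exact h

/-- The annihilation operator `a_m` of mode `m`, as a (closed, unbounded) operator on its maximal
domain. -/
def annihilation {M : ℕ} (m : Fin M) : Fock M →ₗ.[ℂ] Fock M where
  domain := annihilationDomain m
  toFun :=
    { toFun := fun ψ => ⟨lowering m (ψ : Fock M), ψ.2⟩
      map_add' := fun ψ φ => Subtype.ext (map_add (lowering m) (⇑(ψ : Fock M)) (⇑(φ : Fock M)))
      map_smul' := fun c ψ => Subtype.ext (map_smul (lowering m) c (⇑(ψ : Fock M))) }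

/-- The Heisenberg relation `U† A U = B` for a unitary `U` and unbounded operators `A`, `B`, as an
identity on the domain of `B`: for `ψ ∈ dom B`, `U ψ ∈ dom A` and `A (U ψ) = U (B ψ)`. -/
def Transforms {M : ℕ} (U : Fock M ≃ₗᵢ[ℂ] Fock M) (A B : Fock M →ₗ.[ℂ] Fock M) : Prop :=
  ∀ ψ : B.domain, (U ψ, U (B ψ)) ∈ A.graph

/-- A multiport beamsplitter: a unitary `U` on the Fock space for which there is an `M × M` unitary
matrix `𝒰` with `U† a_m U = ∑ k, 𝒰 m k a_k` for all `m`. This action determines `U` up to a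
global phase. -/
def IsMultiportBeamsplitter {M : ℕ} (U : Fock M ≃ₗᵢ[ℂ] Fock M) : Prop :=
  ∃ 𝒰 ∈ Matrix.unitaryGroup (Fin M) ℂ,
    ∀ m, Transforms U (annihilation m) (∑ k, 𝒰 m k • annihilation k)

/-- The centre-of-mass mode `a_+ = (a_1 + ⋯ + a_M) / √M`. -/
def centreOfMass (M : ℕ) : Fock M →ₗ.[ℂ] Fock M :=
  ((Real.sqrt M : ℂ))⁻¹ • ∑ m : Fin M, annihilation m

/-! ## States, tensor products with number states, partial trace -/

/-- `U A U†`. -/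
def conjugate {M : ℕ} (U : Fock M ≃ₗᵢ[ℂ] Fock M) (A : Fock M →L[ℂ] Fock M) : Fock M →L[ℂ] Fock M :=
  (U : Fock M →L[ℂ] Fock M) ∘L A ∘L (U.symm : Fock M →L[ℂ] Fock M)

/-- A state of one mode: a positive operator of trace one. -/
structure IsState (ρ : SingleMode →L[ℂ] SingleMode) : Prop where
  isPositive : ρ.IsPositive
  trace_eq_one :
    HasSum (fun p : ℕ => inner ℂ (lp.single 2 p (1 : ℂ) : SingleMode) (ρ (lp.single 2 p 1))) 1

lemma cons_injective {N : ℕ} (k : Fin N → ℕ) :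
    Function.Injective (fun p : ℕ => (Fin.cons p k : Fin (N + 1) → ℕ)) :=
  fun p q h => by simpa using congrFun h 0

/-- The amplitudes of `ψ ⊗ |k⟩`. -/
def tensorAmplitude {N : ℕ} (k : Fin N → ℕ) (ψ : ℕ → ℂ) (n : Fin (N + 1) → ℕ) : ℂ :=
  if Fin.tail n = k then ψ (n 0) else 0

lemma tensorAmplitude_cons {N : ℕ} (k : Fin N → ℕ) (ψ : ℕ → ℂ) (p : ℕ) :
    tensorAmplitude k ψ (Fin.cons p k) = ψ p := by
  simp [tensorAmplitude]

lemma tensorAmplitude_eq_zero {N : ℕ} (k : Fin N → ℕ) (ψ : ℕ → ℂ) (n : Fin (N + 1) → ℕ)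
    (hn : n ∉ Set.range (fun p : ℕ => (Fin.cons p k : Fin (N + 1) → ℕ))) :
    tensorAmplitude k ψ n = 0 := by
  unfold tensorAmplitude
  rw [if_neg]
  rintro rfl
  exact hn ⟨n 0, Fin.cons_self_tail n⟩

lemma tensorAmplitude_memℓp {N : ℕ} (k : Fin N → ℕ) (ψ : SingleMode) :
    Memℓp (tensorAmplitude k ψ) 2 := by
  apply memℓp_gen
  refine ((cons_injective k).summable_iff ?_).1 ?_
  · intro n hn
    simp [tensorAmplitude_eq_zero k ψ n hn]
  · have h := (memℓp_gen_iff (p := 2) (by norm_num)).1 (lp.memℓp ψ)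
    simpa [Function.comp_def, tensorAmplitude_cons] using h

/-- The isometry `ψ ↦ ψ ⊗ |k⟩` from the first mode into `N + 1` modes, `|k⟩` being a number state
of the last `N` modes. -/
def tensorNumber {N : ℕ} (k : Fin N → ℕ) : SingleMode →ₗᵢ[ℂ] Fock (N + 1) where
  toFun ψ := ⟨tensorAmplitude k ψ, tensorAmplitude_memℓp k ψ⟩
  map_add' ψ φ := by
    ext n
    simp only [lp.coeFn_add, Pi.add_apply, tensorAmplitude]
    split_ifs <;> simp
  map_smul' c ψ := by
    ext n
    simp only [lp.coeFn_smul, Pi.smul_apply, tensorAmplitude, RingHom.id_apply]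
    split_ifs <;> simp
  norm_map' ψ := by
    have h2 : (0 : ℝ) < (2 : ENNReal).toReal := by norm_num
    have key : ∑' n, ‖tensorAmplitude k ψ n‖ ^ (2 : ENNReal).toReal
        = ∑' p, ‖ψ p‖ ^ (2 : ENNReal).toReal := by
      rw [← (cons_injective k).tsum_eq (f := fun n => ‖tensorAmplitude k ψ n‖ ^ (2 : ENNReal).toReal)]
      · simp only [tensorAmplitude_cons]
      · intro n hn
        by_contra hr
        exact hn (by simp [tensorAmplitude_eq_zero k ψ n hr])
    rw [lp.norm_eq_tsum_rpow h2, lp.norm_eq_tsum_rpow h2]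
    exact congrArg (fun x => x ^ (1 / (2 : ENNReal).toReal)) key

/-- `⟨k| A |k⟩`, the operator on the first mode obtained by sandwiching `A` between the number state
`|k⟩` of the last `N` modes. -/
def sandwich {N : ℕ} (k : Fin N → ℕ) (A : Fock (N + 1) →L[ℂ] Fock (N + 1)) :
    SingleMode →L[ℂ] SingleMode :=
  ContinuousLinearMap.adjoint (tensorNumber k).toContinuousLinearMap ∘L A ∘L
    (tensorNumber k).toContinuousLinearMap

/-- The partial trace over all modes but the first, `tr_2 ⋯ tr_M A = ∑_k ⟨k| A |k⟩`. (For a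
trace-class `A` the sum converges absolutely in the operator norm.) -/
def partialTrace {N : ℕ} (A : Fock (N + 1) →L[ℂ] Fock (N + 1)) : SingleMode →L[ℂ] SingleMode :=
  ∑' k : Fin N → ℕ, sandwich k A

/-- The operator `ρ₁ ⊗ |0⟩⟨0|^{⊗ N}` on `N + 1` modes. -/
def tensorVacuum {N : ℕ} (ρ₁ : SingleMode →L[ℂ] SingleMode) : Fock (N + 1) →L[ℂ] Fock (N + 1) :=
  (tensorNumber (0 : Fin N → ℕ)).toContinuousLinearMap ∘L ρ₁ ∘L
    ContinuousLinearMap.adjoint (tensorNumber (0 : Fin N → ℕ)).toContinuousLinearMap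

/-- The vacuum-interference state `U (ρ₁ ⊗ |0⟩⟨0|^{⊗ N}) U†`. -/
def vacuumInterference {N : ℕ} (U : Fock (N + 1) ≃ₗᵢ[ℂ] Fock (N + 1))
    (ρ₁ : SingleMode →L[ℂ] SingleMode) : Fock (N + 1) →L[ℂ] Fock (N + 1) :=
  conjugate U (tensorVacuum ρ₁)

/-- A choice of relative modes. Modes `a_+, a_{-2}, …, a_{-M}` satisfying the canonical commutation
relations are given by the unitary `W` with `W a_1 W† = a_+` and `W a_m W† = a_{-m}` for `m ≥ 2`;
the vectors `W |p, k⟩` are then the joint number states of these modes. So any unitary `W` with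
`W a_1 W† = a_+` is a choice of relative modes `a_{-m} := W a_m W†`. -/
def IsCollectiveFrame {N : ℕ} (W : Fock (N + 1) ≃ₗᵢ[ℂ] Fock (N + 1)) : Prop :=
  Transforms W.symm (annihilation 0) (centreOfMass (N + 1))

/-- The reduced centre-of-mass state `tr_- ρ`: the partial trace of `ρ` over the relative modes
`W a_m W†`, `m ≥ 2`, with the number states `W |p, k⟩` of the collective modes. -/
def reducedCentreOfMass {N : ℕ} (W : Fock (N + 1) ≃ₗᵢ[ℂ] Fock (N + 1))
    (ρ : Fock (N + 1) →L[ℂ] Fock (N + 1)) : SingleMode →L[ℂ] SingleMode :=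
  partialTrace (conjugate W.symm ρ)

/-! ## Glauber `P` function and nonclassicality depth -/

lemma coherentAmplitude_memℓp (α : ℂ) :
    Memℓp (fun n : ℕ => (Real.exp (-‖α‖ ^ 2 / 2) : ℂ) * α ^ n / (Real.sqrt n.factorial : ℂ)) 2 := by
  apply memℓp_gen
  have h := (Real.summable_pow_div_factorial (‖α‖ ^ 2)).mul_left (Real.exp (-‖α‖ ^ 2 / 2) ^ 2)
  refine h.congr fun n => ?_
  have hf : (0 : ℝ) ≤ (n.factorial : ℝ) := by positivity
  have e : ‖(Real.exp (-‖α‖ ^ 2 / 2) : ℂ) * α ^ n / (Real.sqrt n.factorial : ℂ)‖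
      = Real.exp (-‖α‖ ^ 2 / 2) * ‖α‖ ^ n / Real.sqrt n.factorial := by
    rw [norm_div, norm_mul, norm_pow, Complex.norm_real, Complex.norm_real,
      Real.norm_of_nonneg (Real.exp_pos _).le, Real.norm_of_nonneg (Real.sqrt_nonneg _)]
  rw [e]
  norm_num
  rw [div_pow, mul_pow, Real.sq_sqrt hf]
  ring

/-- The coherent state `|α⟩ = e^{-|α|²/2} ∑ₙ αⁿ/√(n!) |n⟩`. -/
def coherentState (α : ℂ) : SingleMode :=
  ⟨fun n : ℕ => (Real.exp (-‖α‖ ^ 2 / 2) : ℂ) * α ^ n / (Real.sqrt n.factorial : ℂ),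
    coherentAmplitude_memℓp α⟩

/-- `⟨α|ρ|α⟩`. -/
def coherentExpectation (ρ : SingleMode →L[ℂ] SingleMode) (α : ℂ) : ℂ :=
  inner ℂ (coherentState α) (ρ (coherentState α))

/-- The character `e^{ξ α* - ξ* α}` of the phase space `ℂ`. -/
def phase (ξ α : ℂ) : ℂ := Complex.exp (ξ * star α - star ξ * α)

/-- The Fourier transform `∫ P_ρ(β) e^{ξ β* - ξ* β} d²β` of the Glauber `P` function of `ρ`.
In general `P_ρ` is only a generalised function, but its Fourier transform is a continuous function:
`ρ = ∫ P_ρ(β) |β⟩⟨β| d²β` says that `⟨α|ρ|α⟩ = ∫ P_ρ(β) e^{-|α-β|²} d²β` for all `α` (these numbers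
determine `ρ`), and the Fourier transform turns this convolution into a product whose second factor
is `π e^{-|ξ|²}`. -/
def glauberFourier (ρ : SingleMode →L[ℂ] SingleMode) (ξ : ℂ) : ℂ :=
  (Real.exp (‖ξ‖ ^ 2) : ℂ) * ((Real.pi : ℂ)⁻¹ * ∫ α : ℂ, coherentExpectation ρ α * phase ξ α)

/-- The Fourier transform of `α ↦ (1/(πτ)) ∫ P_ρ(β) e^{-|α-β|²/τ} d²β`, namely that of `P_ρ` times
`e^{-τ|ξ|²}`. -/
def smoothedFourier (ρ : SingleMode →L[ℂ] SingleMode) (τ : ℝ) (ξ : ℂ) : ℂ :=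
  glauberFourier ρ ξ * (Real.exp (-τ * ‖ξ‖ ^ 2) : ℂ)

/-- The smoothed `P` function `α ↦ (1/(πτ)) ∫ P_ρ(β) e^{-|α-β|²/τ} d²β`, by Fourier inversion. -/
def smoothedP (ρ : SingleMode →L[ℂ] SingleMode) (τ : ℝ) (α : ℂ) : ℂ :=
  ((Real.pi : ℂ) ^ 2)⁻¹ * ∫ ξ : ℂ, smoothedFourier ρ τ ξ * phase α ξ

/-- The nonclassicality depth `τ_c(ρ)`: the infimum of the `τ > 0` for which the smoothed `P`
function exists as a function (its Fourier transform is integrable) and is nonnegative everywhere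
(`0 ≤ z` for complex `z` means that `z` is real and nonnegative). -/
def nonclassicalityDepth (ρ : SingleMode →L[ℂ] SingleMode) : ℝ :=
  sInf {τ : ℝ | 0 < τ ∧ MeasureTheory.Integrable (smoothedFourier ρ τ) ∧
    ∀ α : ℂ, 0 ≤ smoothedP ρ τ α}

end CVModes

end

/-! Put `V = W† U` and `φ n = V |n,0,…,0⟩`. Modes other than the first annihilate `|n,0,…,0⟩`, so
the hypothesis on `U` makes every `a_m` send `U |n,0⟩` to `√(n/M) U |n-1,0⟩`. Averaging over `m` and
passing to the frame `W` gives `a_1 φ n = √n φ (n-1)` (`annihilation_zero_frame`). Unit vectors with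
this property all have the form `|n⟩ ⊗ χ` with one common unit vector `χ`
(`exists_eq_number_tensor`). Hence `V (ψ ⊗ |0⟩) = ψ ⊗ χ`, each term of the partial trace is `|χ k|²
ρ₁` (`sandwich_conjugate_tensorVacuum`), and `∑ |χ k|² = 1`. -/

namespace LinearPMap

/-! ### Calculus of graphs: membership carries the domain conditions of unbounded sums along with
their values. -/

variable {R E F : Type*} [Field R] [AddCommGroup E] [Module R E] [AddCommGroup F] [Module R F]

theorem zero_mem_graph (x : E) : (x, (0 : F)) ∈ (0 : E →ₗ.[R] F).graph :=
  (LinearPMap.mem_graph_iff _).2 ⟨⟨x, Submodule.mem_top⟩, rfl, rfl⟩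

theorem add_mem_graph {f g : E →ₗ.[R] F} {x : E} {y z : F} (hy : (x, y) ∈ f.graph)
    (hz : (x, z) ∈ g.graph) : (x, y + z) ∈ (f + g).graph := by
  obtain ⟨⟨x, h⟩, rfl, rfl⟩ := (LinearPMap.mem_graph_iff _).1 hy
  obtain ⟨⟨x', h'⟩, rfl, rfl⟩ := (LinearPMap.mem_graph_iff _).1 hz
  exact (LinearPMap.mem_graph_iff _).2 ⟨⟨x', h, h'⟩, rfl, rfl⟩

theorem smul_mem_graph {f : E →ₗ.[R] F} {x : E} {y : F} (a : R) (hy : (x, y) ∈ f.graph) :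
    (x, a • y) ∈ (a • f).graph := by
  obtain ⟨⟨x, h⟩, rfl, rfl⟩ := (LinearPMap.mem_graph_iff _).1 hy
  exact (LinearPMap.mem_graph_iff _).2 ⟨⟨x, h⟩, rfl, rfl⟩

theorem sum_mem_graph {ι : Type*} {f : ι → E →ₗ.[R] F} {x : E} {y : ι → F} (s : Finset ι)
    (h : ∀ i ∈ s, (x, y i) ∈ (f i).graph) : (x, ∑ i ∈ s, y i) ∈ (∑ i ∈ s, f i).graph := by
  classical
  induction s using Finset.induction_on with
  | empty => simp [zero_mem_graph x]
  | insert i s hi ih =>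
    rw [Finset.sum_insert hi, Finset.sum_insert hi]
    exact add_mem_graph (h i (Finset.mem_insert_self i s))
      (ih fun j hj => h j (Finset.mem_insert_of_mem hj))

theorem inv_smul_mem_graph {f : E →ₗ.[R] F} {x : E} {y : F} {a : R} (ha : a ≠ 0)
    (hy : (x, y) ∈ (a • f).graph) : (x, a⁻¹ • y) ∈ f.graph := by
  obtain ⟨⟨x, h⟩, rfl, rfl⟩ := (LinearPMap.mem_graph_iff _).1 hy
  refine (LinearPMap.mem_graph_iff _).2 ⟨⟨x, h⟩, rfl, ?_⟩
  rw [LinearPMap.smul_apply, inv_smul_smul₀ ha]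

end LinearPMap

namespace CVModes

/-! ### Heisenberg relations on the number states of the first mode. -/

theorem Transforms.mem_graph {M : ℕ} {U : Fock M ≃ₗᵢ[ℂ] Fock M} {A B : Fock M →ₗ.[ℂ] Fock M}
    (h : Transforms U A B) {x y : Fock M} (hxy : (x, y) ∈ B.graph) : (U x, U y) ∈ A.graph := by
  obtain ⟨x, rfl, rfl⟩ := (LinearPMap.mem_graph_iff _).1 hxy
  exact h x

/-- The domain is maximal and `y` is already square-summable, so the domain condition follows from
the equality of amplitudes. -/
theorem mem_graph_annihilation_iff {M : ℕ} {m : Fin M} {x y : Fock M} :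
    (x, y) ∈ (annihilation m).graph ↔ lowering m x = y := by
  constructor
  · intro h
    obtain ⟨x, rfl, rfl⟩ := (LinearPMap.mem_graph_iff _).1 h
    rfl
  · intro h
    have hx : x ∈ annihilationDomain m := by
      change Memℓp (lowering m x) 2
      rw [h]
      exact lp.memℓp y
    exact (LinearPMap.mem_graph_iff _).2 ⟨⟨x, hx⟩, rfl, Subtype.ext h⟩

/-- The number state `|n, 0, …, 0⟩` of `N + 1` modes. -/
noncomputable def firstNumberState (N n : ℕ) : Fock (N + 1) :=
  tensorNumber (0 : Fin N → ℕ) (lp.single 2 n (1 : ℂ))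

theorem firstNumberState_apply (N n : ℕ) (x : Fin (N + 1) → ℕ) :
    firstNumberState N n x = if Fin.tail x = 0 ∧ x 0 = n then 1 else 0 := by
  change (if Fin.tail x = 0 then (lp.single 2 n (1 : ℂ) : SingleMode) (x 0) else 0) = _
  by_cases h : Fin.tail x = 0 <;> by_cases h' : x 0 = n <;>
    simp [h, h', lp.single_apply]

theorem norm_firstNumberState (N n : ℕ) : ‖firstNumberState N n‖ = 1 := by
  rw [firstNumberState, LinearIsometry.norm_map, lp.norm_single (by norm_num), norm_one]

theorem lowering_zero_cons {N : ℕ} (ψ : (Fin (N + 1) → ℕ) → ℂ) (p : ℕ) (k : Fin N → ℕ) :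
    lowering 0 ψ (Fin.cons p k) = (Real.sqrt (p + 1) : ℂ) * ψ (Fin.cons (p + 1) k) := by
  have h : (Fin.cons p k + Pi.single 0 1 : Fin (N + 1) → ℕ) = Fin.cons (p + 1) k := by
    funext i
    refine Fin.cases ?_ (fun j => ?_) i <;> simp
  simp [lowering, h]

/-- At `n = 0` the truncated `n - 1` is harmless because its coefficient is `√0 = 0`. -/
theorem annihilation_zero_firstNumberState (N n : ℕ) :
    (firstNumberState N n, (Real.sqrt n : ℂ) • firstNumberState N (n - 1)) ∈
      (annihilation (0 : Fin (N + 1))).graph := by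
  rw [mem_graph_annihilation_iff]
  funext x
  obtain ⟨p, k, rfl⟩ : ∃ p k, x = Fin.cons p k := ⟨x 0, Fin.tail x, (Fin.cons_self_tail x).symm⟩
  rw [lowering_zero_cons, lp.coeFn_smul, Pi.smul_apply, firstNumberState_apply,
    firstNumberState_apply, smul_eq_mul]
  rcases n with _ | n
  · simp
  · by_cases h : p = n
    · subst h; simp
    · simp [h]

theorem annihilation_firstNumberState {N : ℕ} (n : ℕ) {m : Fin (N + 1)} (hm : m ≠ 0) :
    (firstNumberState N n, 0) ∈ (annihilation m).graph := by
  obtain ⟨j, rfl⟩ := Fin.exists_succ_eq.2 hm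
  rw [mem_graph_annihilation_iff]
  funext x
  have h : Fin.tail (x + Pi.single j.succ 1) ≠ 0 := fun h => by
    simpa [Fin.tail] using congrFun h j
  change _ * firstNumberState N n (x + Pi.single j.succ 1) = 0
  rw [firstNumberState_apply, if_neg (fun h' => h h'.1), mul_zero]

/-- A multiport that spreads the first mode evenly over all modes, read in a collective frame,
commutes with `a_1` on the number states of the first mode. -/
theorem annihilation_zero_frame {N : ℕ} {U W : Fock (N + 1) ≃ₗᵢ[ℂ] Fock (N + 1)}
    {c : Fin (N + 1) → Fin (N + 1) → ℂ}
    (hc : ∀ m, Transforms U ((Real.sqrt (N + 1 : ℕ) : ℂ) • annihilation m)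
      (annihilation 0 + ∑ m' ∈ Finset.univ.erase 0, c m m' • annihilation m'))
    (hW : IsCollectiveFrame W) (n : ℕ) :
    (W.symm (U (firstNumberState N n)),
      (Real.sqrt n : ℂ) • W.symm (U (firstNumberState N (n - 1)))) ∈
      (annihilation (0 : Fin (N + 1))).graph := by
  set s : ℂ := (Real.sqrt (N + 1 : ℕ) : ℂ) with hs
  have hs2 : s * s = (N + 1 : ℕ) := by
    rw [hs, ← Complex.ofReal_mul, Real.mul_self_sqrt (Nat.cast_nonneg _), Complex.ofReal_natCast]
  have hs0 : s ≠ 0 := fun h => by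
    rw [h, mul_zero] at hs2
    exact Nat.cast_ne_zero.2 (Nat.succ_ne_zero N) hs2.symm
  have hm : ∀ m, (U (firstNumberState N n),
      s⁻¹ • (Real.sqrt n : ℂ) • U (firstNumberState N (n - 1))) ∈ (annihilation m).graph := by
    intro m
    refine LinearPMap.inv_smul_mem_graph hs0 ?_
    rw [← map_smul]
    refine (hc m).mem_graph ?_
    -- All terms with coefficients `c m m'` vanish on `|n,0,…,0⟩`, leaving only `a_1`.
    have h := LinearPMap.add_mem_graph (annihilation_zero_firstNumberState N n)
      (LinearPMap.sum_mem_graph (Finset.univ.erase 0) fun m' hm' =>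
        LinearPMap.smul_mem_graph (c m m')
          (annihilation_firstNumberState n (Finset.ne_of_mem_erase hm')))
    simpa using h
  have hsum := hW.mem_graph (LinearPMap.smul_mem_graph s⁻¹
    (LinearPMap.sum_mem_graph Finset.univ fun m _ => hm m))
  convert hsum using 2
  -- The `N + 1` equal terms each carry `s⁻¹ * s⁻¹`, and `s * s = N + 1`.
  rw [Finset.sum_const, Finset.card_univ, Fintype.card_fin, ← Nat.cast_smul_eq_nsmul ℂ, ← hs2,
    smul_smul, smul_smul, mul_assoc, mul_assoc, mul_inv_cancel₀ hs0, mul_one, inv_mul_cancel₀ hs0,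
    one_smul, map_smul]

/-! ### Rigidity of sequences lowered like number states. -/

theorem hasSum_sq_norm {ι : Type*} (f : lp (fun _ : ι => ℂ) 2) :
    HasSum (fun i => ‖f i‖ ^ 2) (‖f‖ ^ 2) := by
  have h := lp.hasSum_norm (p := 2) (by norm_num) f
  simpa using h

/-- Unit vectors `φ n` that `a_1` lowers like number states are of the form `|n⟩ ⊗ χ` with a unit
vector `χ`. -/
theorem exists_eq_number_tensor {N : ℕ} {φ : ℕ → Fock (N + 1)} (hφ : ∀ n, ‖φ n‖ = 1)
    (ha : ∀ n, (φ n, (Real.sqrt n : ℂ) • φ (n - 1)) ∈ (annihilation (0 : Fin (N + 1))).graph) :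
    ∃ χ : (Fin N → ℕ) → ℂ, HasSum (fun k => ‖χ k‖ ^ 2) 1 ∧
      ∀ n p k, φ n (Fin.cons p k) = if p = n then χ k else 0 := by
  have hinj (n : ℕ) : Function.Injective (fun k : Fin N → ℕ => (Fin.cons n k : Fin (N + 1) → ℕ)) :=
    fun k l h => (Fin.cons_inj.1 h).2
  have hlow (n p : ℕ) (k : Fin N → ℕ) : (Real.sqrt (p + 1) : ℂ) * φ n (Fin.cons (p + 1) k) =
      (Real.sqrt n : ℂ) * φ (n - 1) (Fin.cons p k) := by
    rw [← lowering_zero_cons, mem_graph_annihilation_iff.1 (ha n)]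
    rfl
  have hsqrt (p : ℕ) : (Real.sqrt (p + 1) : ℂ) ≠ 0 :=
    Complex.ofReal_ne_zero.2 (Real.sqrt_pos.2 (by positivity)).ne'
  have hsum (n : ℕ) : HasSum (fun x => ‖φ n x‖ ^ 2) 1 := by
    simpa [hφ n] using hasSum_sq_norm (φ n)
  -- `φ 0` is killed by `a_1`, so it lives on the slice `p = 0`; its amplitudes there are `χ`.
  have hzero (p : ℕ) (k : Fin N → ℕ) : φ 0 (Fin.cons (p + 1) k) = 0 := by
    simpa [hsqrt p] using hlow 0 p k
  have hsucc (n p : ℕ) (k : Fin N → ℕ) :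
      φ (n + 1) (Fin.cons (p + 1) k) * (Real.sqrt (p + 1) : ℂ) =
        φ n (Fin.cons p k) * (Real.sqrt (n + 1) : ℂ) := by
    simpa [mul_comm] using hlow (n + 1) p k
  have hdiag (n : ℕ) (k : Fin N → ℕ) : φ n (Fin.cons n k) = φ 0 (Fin.cons 0 k) := by
    induction n with
    | zero => rfl
    | succ n ih => rw [← ih]; exact mul_right_cancel₀ (hsqrt n) (hsucc n n k)
  have hχ : HasSum (fun k => ‖φ 0 (Fin.cons 0 k)‖ ^ 2) 1 := by
    refine ((hinj 0).hasSum_iff (f := fun x => ‖φ 0 x‖ ^ 2) fun x hx => ?_).2 (hsum 0)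
    rcases hx0 : x 0 with _ | p
    · exact absurd ⟨Fin.tail x, by rw [← hx0]; exact Fin.cons_self_tail x⟩ hx
    · rw [← Fin.cons_self_tail x, hx0, hzero]
      simp
  refine ⟨fun k => φ 0 (Fin.cons 0 k), hχ, fun n p k => ?_⟩
  split_ifs with h
  · rw [h, hdiag]
  -- The slice `p = n` of `φ n` is a copy of `χ`, so it already exhausts the unit norm; the
  -- remaining nonnegative terms sum to zero and vanish.
  have hn : HasSum (fun x => if x 0 = n then ‖φ n x‖ ^ 2 else 0) 1 := by
    refine ((hinj n).hasSum_iff fun x hx => if_neg fun hx0 => hx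
      ⟨Fin.tail x, by rw [← hx0]; exact Fin.cons_self_tail x⟩).1 ?_
    simpa [Function.comp_def, hdiag] using hχ
  have hd := (hsum n).sub hn
  rw [sub_self, hasSum_zero_iff_of_nonneg] at hd
  · simpa [h] using congrFun hd (Fin.cons p k)
  · intro x
    dsimp only [Pi.zero_apply]
    split_ifs
    · simp
    · simp

/-! ### Evaluation of the partial trace. -/

theorem adjoint_tensorNumber_apply {N : ℕ} (k : Fin N → ℕ) (φ : Fock (N + 1)) (p : ℕ) :
    ContinuousLinearMap.adjoint (tensorNumber k).toContinuousLinearMap φ p = φ (Fin.cons p k) := by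
  have h : tensorNumber k (lp.single 2 p (1 : ℂ)) = lp.single 2 (Fin.cons p k) (1 : ℂ) := by
    ext x
    change (if Fin.tail x = k then (lp.single 2 p (1 : ℂ) : SingleMode) (x 0) else 0) = _
    obtain ⟨q, l, rfl⟩ : ∃ q l, x = Fin.cons q l := ⟨x 0, Fin.tail x, (Fin.cons_self_tail x).symm⟩
    by_cases h : l = k <;> by_cases h' : q = p <;>
      simp [h, h', lp.single_apply, Fin.cons_inj]
  have h1 := lp.inner_single_left (𝕜 := ℂ) (G := fun _ : ℕ => ℂ) p 1
    (ContinuousLinearMap.adjoint (tensorNumber k).toContinuousLinearMap φ)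
  have h2 := lp.inner_single_left (𝕜 := ℂ) (G := fun _ : Fin (N + 1) → ℕ => ℂ) (Fin.cons p k) 1 φ
  rw [ContinuousLinearMap.adjoint_inner_right, LinearIsometry.coe_toContinuousLinearMap, h, h2] at h1
  simpa using h1.symm

/-- A bounded operator that acts on the number states of the first mode as `|n, 0⟩ ↦ |n⟩ ⊗ χ`
satisfies `⟨k| V (ψ ⊗ |0⟩) = χ k ψ`. -/
theorem adjoint_tensorNumber_comp {N : ℕ} {V : Fock (N + 1) →L[ℂ] Fock (N + 1)}
    {χ : (Fin N → ℕ) → ℂ}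
    (hV : ∀ n p k, V (firstNumberState N n) (Fin.cons p k) = if p = n then χ k else 0)
    (k : Fin N → ℕ) :
    ContinuousLinearMap.adjoint (tensorNumber k).toContinuousLinearMap ∘L V ∘L
      (tensorNumber (0 : Fin N → ℕ)).toContinuousLinearMap =
      χ k • ContinuousLinearMap.id ℂ SingleMode := by
  -- Bounded operators on `ℓ²` are determined by their values on number states.
  refine lp.ext_continuousLinearMap (by norm_num) fun n => ?_
  ext p
  change ContinuousLinearMap.adjoint (tensorNumber k).toContinuousLinearMap
    (V (firstNumberState N n)) p = χ k * (lp.single 2 n (1 : ℂ) : SingleMode) p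
  rw [adjoint_tensorNumber_apply, hV]
  by_cases h : p = n <;> simp [h, lp.single_apply]

theorem sandwich_conjugate_tensorVacuum {N : ℕ} {V : Fock (N + 1) ≃ₗᵢ[ℂ] Fock (N + 1)}
    {χ : (Fin N → ℕ) → ℂ}
    (hV : ∀ n p k, V (firstNumberState N n) (Fin.cons p k) = if p = n then χ k else 0)
    (k : Fin N → ℕ) (ρ : SingleMode →L[ℂ] SingleMode) :
    sandwich k (conjugate V (tensorVacuum ρ)) = ((‖χ k‖ ^ 2 : ℝ) : ℂ) • ρ := by
  have h := adjoint_tensorNumber_comp (V := (V : Fock (N + 1) →L[ℂ] Fock (N + 1))) hV k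
  -- The adjoint identity supplies the right-hand factor `⟨0| V† |k⟩ = conj (χ k)`, so the two
  -- scalars multiply to `|χ k|²`.
  have h' := congrArg ContinuousLinearMap.adjoint h
  rw [ContinuousLinearMap.adjoint_comp, ContinuousLinearMap.adjoint_comp,
    ContinuousLinearMap.adjoint_adjoint, LinearIsometryEquiv.adjoint_eq_symm, map_smulₛₗ,
    ContinuousLinearMap.adjoint_id] at h'
  have hd : sandwich k (conjugate V (tensorVacuum ρ)) =
      (ContinuousLinearMap.adjoint (tensorNumber k).toContinuousLinearMap ∘L
        (V : Fock (N + 1) →L[ℂ] Fock (N + 1)) ∘L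
          (tensorNumber (0 : Fin N → ℕ)).toContinuousLinearMap) ∘L ρ ∘L
      ((ContinuousLinearMap.adjoint (tensorNumber (0 : Fin N → ℕ)).toContinuousLinearMap ∘L
        (V.symm : Fock (N + 1) →L[ℂ] Fock (N + 1))) ∘L
          (tensorNumber k).toContinuousLinearMap) := rfl
  rw [hd, h, h']
  ext1 ψ
  simp [smul_smul, ← Complex.mul_conj', mul_comm]

end CVModes

theorem mainTheorem6 (N : ℕ)
    (U : CVModes.Fock (N + 1) ≃ₗᵢ[ℂ] CVModes.Fock (N + 1))
    (hU : CVModes.IsMultiportBeamsplitter U)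
    (c : Fin (N + 1) → Fin (N + 1) → ℂ)
    (hc : ∀ m, CVModes.Transforms U
      ((Real.sqrt (N + 1 : ℕ) : ℂ) • CVModes.annihilation m)
      (CVModes.annihilation 0 + ∑ m' ∈ Finset.univ.erase 0, c m m' • CVModes.annihilation m'))
    (W : CVModes.Fock (N + 1) ≃ₗᵢ[ℂ] CVModes.Fock (N + 1))
    (hW : CVModes.IsCollectiveFrame W)
    (ρ₁ : CVModes.SingleMode →L[ℂ] CVModes.SingleMode)
    (hρ₁ : CVModes.IsState ρ₁) :
    Summable (fun k : Fin N → ℕ =>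
        CVModes.sandwich k (CVModes.conjugate W.symm (CVModes.vacuumInterference U ρ₁))) ∧
      CVModes.reducedCentreOfMass W (CVModes.vacuumInterference U ρ₁) = ρ₁ ∧
      CVModes.nonclassicalityDepth
          (CVModes.reducedCentreOfMass W (CVModes.vacuumInterference U ρ₁)) =
        CVModes.nonclassicalityDepth ρ₁ := by
  obtain ⟨χ, hχ, hφ⟩ := CVModes.exists_eq_number_tensor
    (φ := fun n => (U.trans W.symm) (CVModes.firstNumberState N n))
    (fun n => by rw [LinearIsometryEquiv.norm_map, CVModes.norm_firstNumberState])
    (CVModes.annihilation_zero_frame hc hW)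
  have hk : ∀ k : Fin N → ℕ,
      CVModes.sandwich k (CVModes.conjugate W.symm (CVModes.vacuumInterference U ρ₁)) =
        ((‖χ k‖ ^ 2 : ℝ) : ℂ) • ρ₁ :=
    fun k => CVModes.sandwich_conjugate_tensorVacuum hφ k ρ₁
  have hsum : HasSum (fun k : Fin N → ℕ =>
      CVModes.sandwich k (CVModes.conjugate W.symm (CVModes.vacuumInterference U ρ₁))) ρ₁ := by
    simp only [hk]
    simpa using (Complex.hasSum_ofReal.2 hχ).smul_const ρ₁
  have htr : CVModes.reducedCentreOfMass W (CVModes.vacuumInterference U ρ₁) = ρ₁ := hsum.tsum_eq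
  exact ⟨hsum.summable, htr, congrArg CVModes.nonclassicalityDepth htr⟩
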